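/- Let $X$ be a quasi-compact semi-separated scheme (semi-separated means that the diagonal morphism $X\to X\times_{\mathbb Z}X$ is affine), and let $X=\bigcup_{\alpha=1}^N U_\alpha$ be a covering of $X$ by $N$ affine open subschemes. Let $X\text{-}\mathrm{Qcoh}$ denote the category of quasi-coherent sheaves of $\mathcal O_X$-modules. Then $X\text{-}\mathrm{Qcoh}$ satisfies the Roos axiom $\mathrm{AB}4^*\text{-}n$ with $n=N-1$; that is, $X\text{-}\mathrm{Qcoh}$ is an abelian category with products of families indexed by arbitrary sets and with enough injective objects, and for every set $\Lambda$ and every family $(\mathcal M_\lambda)_{\lambda\in\Lambda}$ of quasi-coherent sheaves on $X$ one has $$\prod\nolimits_{\lambda\in\Lambda}^{(i)}\mathcal M_\lambda=0\qquad\text{for all } i>N-1 .$$ Here $\prod_{\lambda\in\Lambda}^{(i)}$ denotes the $i$-th right derived functor of the functor $\prod_{\lambda\in\Lambda}\colon (X\text{-}\mathrm{Qcoh})^{\Lambda}\to X\text{-}\mathrm{Qcoh}$, $(\mathcal M_\lambda)_\lambda\mapsto\prod_\lambda\mathcal M_\lambda$, where the product is taken in $X\text{-}\mathrm{Qcoh}$.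 -/

import Mathlib

open CategoryTheory CategoryTheory.Limits AlgebraicGeometry

universe w v u

noncomputable section

namespace RoosAxiom

section Families

variable (Λ : Type w) (C : Type u) [Category.{v} C]

/-- If `C` has enough injectives, so does the category `C^Λ` of `Λ`-indexed families of objects
of `C`, written as the category of functors `Discrete Λ ⥤ C`. -/
instance enoughInjectives_family [Abelian C] [EnoughInjectives C] :
    EnoughInjectives (Discrete Λ ⥤ C) where
  presentation F :=
    let J (k : Discrete Λ) : C := Injective.under (F.obj k)
    let ι : F ⟶ Discrete.functor fun l : Λ ↦ J ⟨l⟩ :=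
      Discrete.natTrans fun k ↦ Injective.ι (F.obj k)
    have : ∀ k, Mono (ι.app k) := fun k ↦ inferInstanceAs (Mono (Injective.ι (F.obj k)))
    ⟨{ J := Discrete.functor fun l : Λ ↦ J ⟨l⟩
       injective :=
         { factors := fun {X Y} g f hf ↦ by
             have hf' : ∀ k : Discrete Λ, Mono (f.app k) :=
               (NatTrans.mono_iff_mono_app f).1 hf
             have hJ : ∀ k, Injective (J k) := fun k ↦ by dsimp only [J]; infer_instance
             let h (k : Discrete Λ) : Y.obj k ⟶ J k :=
               Injective.factorThru (J := J k) (g.app k : X.obj k ⟶ J k) (f.app k)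
             refine ⟨Discrete.natTrans h, ?_⟩
             ext k
             exact Injective.comp_factorThru (J := J k) (g.app k : X.obj k ⟶ J k) (f.app k) }
       f := ι
       mono := NatTrans.mono_of_mono_app _ }⟩

/-- The product functor `C^Λ ⥤ C` sending `(A_l)_l` to `∏ A_l`. -/
def prodFunctor [HasProductsOfShape Λ C] : (Discrete Λ ⥤ C) ⥤ C :=
  lim

instance additive_prodFunctor [Abelian C] [HasProductsOfShape Λ C] :
    (prodFunctor Λ C).Additive where
  map_add {F G f g} := by
    refine limit.hom_ext fun j ↦ ?_
    refine Eq.trans ?_ (Preadditive.add_comp _ _ _ (limMap f) (limMap g) (limit.π G j)).symm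
    simp [prodFunctor, Preadditive.comp_add]

/-- The derived product `∏^{(i)} A_l`: the value at the family `(A_l)_l` of the `i`-th right
derived functor of the product functor `C^Λ ⥤ C`. -/
def derivedProduct {Λ : Type w} {C : Type u} [Category.{v} C] [Abelian C]
    [HasProductsOfShape Λ C] [EnoughInjectives C] (i : ℕ) (A : Λ → C) : C :=
  ((prodFunctor Λ C).rightDerived i).obj (Discrete.functor A)

end Families

/-- The Roos axiom `AB4*-n`: the category `C` is abelian, has products of families indexed by
arbitrary sets (of the universe `w`) and enough injective objects, and for every family of objects
the derived products vanish in all degrees `i > n`. (Being abelian is a property of a category: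
its preadditive structure is determined by the underlying category.) -/
def AB4StarN (C : Type u) [Category.{v} C] (n : ℤ) : Prop :=
  ∃ (_ : Abelian C) (_ : HasProducts.{w} C) (_ : EnoughInjectives C),
    ∀ (Λ : Type w) (A : Λ → C) (i : ℕ), n < (i : ℤ) → IsZero (derivedProduct i A)

/-- The category of quasi-coherent sheaves on a scheme, as a full subcategory of the category of
sheaves of modules over the structure sheaf. -/
abbrev Qcoh (X : Scheme.{u}) : Type (u + 1) :=
  ObjectProperty.FullSubcategory (fun M : X.Modules ↦ SheafOfModules.IsQuasicoherent.{u} M)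

end RoosAxiom

end

/-! Write `j_a` for the inclusion of `U_a`. Restriction `j_a^*` is exact. Direct image `j_{a*}` is
exact on quasi-coherent sheaves because affine opens meet in affine opens. Moreover `j_a^* j_{a*}`
is the identity, and a sheaf killed by every `j_a^*` is zero. Quasi-coherent sheaves on `U_a` are
modules over a ring, whose products are exact. As `j_{a*}` preserves injectives, epimorphisms and
products, families of sheaves `j_{a*} N` are acyclic for the product (`derivedVanishing_obj`).

The bound comes from induction on the number of charts where a family `A` may be nonzero
(`derivedVanishing_of_card_le`). The unit `A ⟶ j_{a*} j_a^* A` is invertible on `U_a`, so its kernel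
`K` and cokernel `Q` vanish there, and they vanish on every chart where `A` does: one chart is
gained. With `I` the coimage, the sequences `K ⟶ A ⟶ I` and `I ⟶ j_{a*} j_a^* A ⟶ Q` show that each
chart costs at most one degree. The first chart costs none, whence `N - 1`.

`DerivedVanishing` replaces the long exact sequence by dimension shifting. `ab4StarN_of_adjunctions`
is the resulting abstract theorem; there products and injectives come from the embedding of `M` in
the product of the `j_{a*} j_a^* M`. The geometric part verifies its hypotheses. -/

open CategoryTheory CategoryTheory.Limits AlgebraicGeometry

universe v' u'

noncomputable section

namespace CategoryTheory

/-! ### Dimension shifting for derived functors. -/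

section DerivedVanishing

variable {B : Type*} [Category B] [Abelian B] {C : Type*} [Category C]

/-- A criterion for the vanishing of the `(n + 1)`-st right derived functor of `F` at an object,
expressed by dimension shifting along embeddings into injective objects. -/
inductive DerivedVanishing (F : B ⥤ C) : ℕ → B → Prop
  | zero {A I Q : B} (f : A ⟶ I) (g : I ⟶ Q) (w : f ≫ g = 0)
      (h : (ShortComplex.mk f g w).ShortExact) (hI : Injective I) (hg : Epi (F.map g)) :
      DerivedVanishing F 0 A
  | succ {n : ℕ} {A I Q : B} (f : A ⟶ I) (g : I ⟶ Q) (w : f ≫ g = 0)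
      (h : (ShortComplex.mk f g w).ShortExact) (hI : Injective I)
      (hQ : DerivedVanishing F n Q) : DerivedVanishing F (n + 1) A

namespace DerivedVanishing

variable {F : B ⥤ C}

lemma shortExact_of_iso_left {A A' I Q : B} {f : A ⟶ I} {g : I ⟶ Q} {w : f ≫ g = 0}
    (h : (ShortComplex.mk f g w).ShortExact) (e : A' ≅ A) :
    (ShortComplex.mk (e.hom ≫ f) g (by simp [w])).ShortExact :=
  ShortComplex.shortExact_of_iso (S₁ := ShortComplex.mk f g w)
    (ShortComplex.isoMk e.symm (Iso.refl _) (Iso.refl _) (by simp) (by simp)) h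

lemma of_iso {n : ℕ} {A A' : B} (h : DerivedVanishing F n A) (e : A' ≅ A) :
    DerivedVanishing F n A' := by
  cases h with
  | zero f g w h hI hg => exact .zero _ g _ (shortExact_of_iso_left h e) hI hg
  | succ f g w h hI hQ => exact .succ _ g _ (shortExact_of_iso_left h e) hI hQ

lemma of_isZero (n : ℕ) {A : B} (hA : IsZero A) :
    DerivedVanishing F n A := by
  have h : (ShortComplex.mk (𝟙 A) (𝟙 A) (hA.eq_of_src _ _)).ShortExact :=
    { exact := ShortComplex.exact_of_isZero_X₂ _ hA
      mono_f := inferInstanceAs (Mono (𝟙 A))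
      epi_g := inferInstanceAs (Epi (𝟙 A)) }
  have hI : Injective A := ⟨fun _ _ _ ↦ ⟨0, hA.eq_of_tgt _ _⟩⟩
  induction n with
  | zero => exact .zero _ _ _ h hI (by rw [F.map_id]; infer_instance)
  | succ n ih => exact .succ _ _ _ h hI ih

/-- The simultaneous embedding of the terms of a short exact sequence into injective objects. -/
lemma exists_shortExact_cokernels {S : ShortComplex B} (hS : S.ShortExact)
    {I₁ Q₁ I₃ Q₃ : B} {f₁ : S.X₁ ⟶ I₁} {g₁ : I₁ ⟶ Q₁} {w₁ : f₁ ≫ g₁ = 0}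
    (h₁ : (ShortComplex.mk f₁ g₁ w₁).ShortExact)
    {f₃ : S.X₃ ⟶ I₃} {g₃ : I₃ ⟶ Q₃} {w₃ : f₃ ≫ g₃ = 0}
    (h₃ : (ShortComplex.mk f₃ g₃ w₃).ShortExact) [Injective I₁] :
    ∃ (Q : B) (f : S.X₂ ⟶ I₁ ⊞ I₃) (g : I₁ ⊞ I₃ ⟶ Q) (w : f ≫ g = 0)
      (i : Q₁ ⟶ Q) (p : Q ⟶ Q₃) (wp : i ≫ p = 0),
      (ShortComplex.mk f g w).ShortExact ∧ (ShortComplex.mk i p wp).ShortExact ∧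
      g₁ ≫ i = biprod.inl ≫ g ∧ g ≫ p = biprod.snd ≫ g₃ := by
  have := hS.mono_f
  have := hS.epi_g
  have : Mono f₁ := h₁.mono_f
  have : Epi g₁ := h₁.epi_g
  have : Mono f₃ := h₃.mono_f
  have : Epi g₃ := h₃.epi_g
  let f : S.X₂ ⟶ I₁ ⊞ I₃ := biprod.lift (Injective.factorThru f₁ S.f) (S.g ≫ f₃)
  let L₂ : ShortComplex B := .mk (biprod.inl : I₁ ⟶ I₁ ⊞ I₃) biprod.snd (by simp)
  let v : S ⟶ L₂ :=
    { τ₁ := f₁, τ₂ := f, τ₃ := f₃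
      comm₁₂ := by ext <;> simp [L₂, f]
      comm₂₃ := by simp [L₂, f] }
  have hL₂ : L₂.ShortExact := (ShortComplex.Splitting.ofHasBinaryBiproduct I₁ I₃).shortExact
  let T : ShortComplex.SnakeInput B :=
    { L₀ := kernel v
      L₁ := S
      L₂ := L₂
      L₃ := cokernel v
      v₀₁ := kernel.ι v
      v₁₂ := v
      v₂₃ := cokernel.π v
      h₀ := kernelIsKernel v
      h₃ := cokernelIsCokernel v
      L₁_exact := hS.exact
      epi_L₁_g := hS.epi_g
      L₂_exact := hL₂.exact
      mono_L₂_f := hL₂.mono_f }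
  have h₀ : T.v₀₁.τ₃ = 0 := by
    rw [← cancel_mono f₃, zero_comp]
    exact T.w₀₂_τ₃
  have hz : IsZero T.L₀.X₃ := by
    have : Mono T.v₀₁.τ₃ := ShortComplex.SnakeInput.mono_v₀₁_τ₃ T
    rw [IsZero.iff_id_eq_zero, ← cancel_mono T.v₀₁.τ₃, h₀, comp_zero, comp_zero]
  -- The kernel row ends in zero, so the connecting map vanishes and the cokernel row is also exact
  -- on the left.
  have hf₃ : Mono T.L₃.f :=
    T.L₂'_exact.mono_g (hz.eq_of_src _ _)
  have hg₃ : Epi T.L₃.g := @ShortComplex.SnakeInput.epi_L₃_g _ _ _ T hL₂.epi_g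
  have hf : Mono f := by
    have : Mono v.τ₁ := h₁.mono_f
    have : Mono v.τ₃ := h₃.mono_f
    have : Mono L₂.f := hL₂.mono_f
    exact ShortComplex.mono_τ₂_of_exact_of_mono v hS.exact
  let e₁ : Q₁ ≅ T.L₃.X₁ := h₁.gIsCokernel.coconePointUniqueUpToIso T.h₃τ₁
  let e₃ : Q₃ ≅ T.L₃.X₃ := h₃.gIsCokernel.coconePointUniqueUpToIso T.h₃τ₃
  have he₁ : g₁ ≫ e₁.hom = T.v₂₃.τ₁ :=
    h₁.gIsCokernel.comp_coconePointUniqueUpToIso_hom T.h₃τ₁ WalkingParallelPair.one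
  have he₃ : g₃ ≫ e₃.hom = T.v₂₃.τ₃ :=
    h₃.gIsCokernel.comp_coconePointUniqueUpToIso_hom T.h₃τ₃ WalkingParallelPair.one
  refine ⟨T.L₃.X₂, f, T.v₂₃.τ₂, T.w₁₃_τ₂, e₁.hom ≫ T.L₃.f, T.L₃.g ≫ e₃.inv, by simp,
    { exact := T.exact_C₂_down, mono_f := hf, epi_g := ShortComplex.SnakeInput.epi_v₂₃_τ₂ T },
    ?_, ?_, ?_⟩
  · exact ShortComplex.shortExact_of_iso
      (ShortComplex.isoMk e₁.symm (Iso.refl _) e₃.symm (by simp) (by simp))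
      { exact := T.L₃_exact, mono_f := hf₃, epi_g := hg₃ : T.L₃.ShortExact }
  · rw [reassoc_of% he₁]
    exact T.v₂₃.comm₁₂
  · rw [← cancel_mono e₃.hom, Category.assoc, Category.assoc, Category.assoc, he₃, e₃.inv_hom_id,
      Category.comp_id]
    exact T.v₂₃.comm₂₃

section Extensions

variable [Abelian C] [PreservesFiniteLimits F] [F.Additive]

/-- Derived vanishing is stable under extensions. -/
lemma of_shortExact {n : ℕ} : ∀ {S : ShortComplex B}, S.ShortExact →
    DerivedVanishing F n S.X₁ → DerivedVanishing F n S.X₃ → DerivedVanishing F n S.X₂ := by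
  induction n with
  | zero =>
    intro S hS h₁ h₃
    cases h₁ with
    | @zero _ I₁ _ f₁ g₁ w₁ h₁ hI₁ hg₁ =>
    cases h₃ with
    | @zero _ I₃ _ f₃ g₃ w₃ h₃ hI₃ hg₃ =>
    obtain ⟨Q, f, g, w, i, p, wp, h, h', hi, hp⟩ := exists_shortExact_cokernels hS h₁ h₃
    refine .zero f g w h inferInstance ?_
    have := h'.mono_f
    let L : ShortComplex B := .mk (biprod.inl : I₁ ⟶ I₁ ⊞ I₃) biprod.snd biprod.inl_snd
    let φ : L ⟶ .mk i p wp := { τ₁ := g₁, τ₂ := g, τ₃ := g₃, comm₁₂ := hi, comm₂₃ := hp }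
    -- The four lemma applies to the image under `F`: the bottom row is exact in the middle by left
    -- exactness, and the top row stays epi because it splits.
    have hF : ((ShortComplex.mk i p wp).map F).Exact :=
      h'.exact.map_of_mono_of_preservesKernel F h'.mono_f inferInstance
    have : Epi (F.mapShortComplex.map φ).τ₁ := hg₁
    have : Epi (F.mapShortComplex.map φ).τ₃ := hg₃
    have : Epi (F.mapShortComplex.obj L).g := inferInstanceAs (Epi (F.map biprod.snd))
    have : Epi (F.mapShortComplex.obj (.mk i p wp)).g := by
      have : Epi (F.map (biprod.snd : I₁ ⊞ I₃ ⟶ I₃) ≫ F.map g₃) := inferInstance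
      rw [← F.map_comp, ← hp, F.map_comp] at this
      exact epi_of_epi (F.map g) (F.map p)
    exact ShortComplex.epi_τ₂_of_exact_of_epi (F.mapShortComplex.map φ) hF
  | succ n ih =>
    intro S hS h₁ h₃
    cases h₁ with
    | succ f₁ g₁ w₁ h₁ hI₁ hQ₁ =>
    cases h₃ with
    | succ f₃ g₃ w₃ h₃ hI₃ hQ₃ =>
    obtain ⟨Q, f, g, w, i, p, wp, h, h', hi, hp⟩ := exists_shortExact_cokernels hS h₁ h₃
    exact .succ f g w h inferInstance (ih h' hQ₁ hQ₃)

/-- Derived vanishing for the kernel of an epimorphism. -/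
lemma of_shortExact_left {n : ℕ} {S : ShortComplex B} (hS : S.ShortExact)
    (h₂ : DerivedVanishing F (n + 1) S.X₂) (h₃ : DerivedVanishing F n S.X₃) :
    DerivedVanishing F (n + 1) S.X₁ := by
  cases h₂ with
  | @succ _ _ I Q f g w h hI hQ =>
  have : Mono S.f := hS.mono_f
  have : Mono f := h.mono_f
  have hz : IsZero (kernel f) := by
    rw [IsZero.iff_id_eq_zero, ← cancel_mono (kernel.ι f), ← cancel_mono f]
    simp
  have hex := kernelCokernelCompSequence_exact S.f f
  let e₁ : S.X₃ ≅ cokernel S.f := hS.gIsCokernel.coconePointUniqueUpToIso (colimit.isColimit _)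
  let e₃ : Q ≅ cokernel f := h.gIsCokernel.coconePointUniqueUpToIso (colimit.isColimit _)
  refine .succ (S.f ≫ f) (cokernel.π (S.f ≫ f)) (cokernel.condition _)
    { exact := ShortComplex.exact_cokernel _
      mono_f := inferInstanceAs (Mono (S.f ≫ f))
      epi_g := inferInstanceAs (Epi (cokernel.π _)) } hI ?_
  -- The subobject `X₁` of `I` has quotient an extension of `I / X₂` by `X₂ / X₁`, and both ends
  -- vanish at level `n`.
  refine of_shortExact (S := .mk (cokernel.map S.f (S.f ≫ f) (𝟙 _) f (by simp))
    (cokernel.map (S.f ≫ f) f S.f (𝟙 _) (by simp)) (by ext; simp)) ?_ (h₃.of_iso e₁.symm)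
      (hQ.of_iso e₃.symm)
  exact
    { exact := hex.exact 3
      mono_f := (hex.exact 2).mono_g (hz.eq_of_src _ _)
      epi_g := epi_of_epi_fac (f := cokernel.π (S.f ≫ f)) (h := cokernel.π f) (by simp) }

end Extensions

/-- As `L` preserves monomorphisms, `R` preserves injectives; being exact, it carries each injective
embedding in `D` and its cokernel to such a sequence in `B`. -/
lemma of_adjunction {D : Type*} [Category D] [Abelian D]
    [EnoughInjectives D] {L : B ⥤ D} {R : D ⥤ B} (adj : L ⊣ R) [L.PreservesMonomorphisms]
    [R.PreservesEpimorphisms] (hF : ∀ {X Y : D} (g : X ⟶ Y) [Epi g], Epi (F.map (R.map g)))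
    (n : ℕ) (N : D) : DerivedVanishing F n (R.obj N) := by
  have := adj.isRightAdjoint
  have (N : D) : ∃ (I Q : D) (f : N ⟶ I) (g : I ⟶ Q) (w : f ≫ g = 0) (_ : Epi g)
      (_ : Injective I), (ShortComplex.mk (R.map f) (R.map g)
        (by rw [← R.map_comp, w, R.map_zero])).ShortExact := by
    refine ⟨_, _, Injective.ι N, cokernel.π _, cokernel.condition _, inferInstance,
      inferInstance, ?_⟩
    have h : (ShortComplex.mk (Injective.ι N) _ (cokernel.condition _)).Exact :=
      ShortComplex.exact_cokernel _
    exact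
      { exact := h.map_of_mono_of_preservesKernel R (inferInstanceAs (Mono (Injective.ι N)))
          inferInstance
        mono_f := inferInstanceAs (Mono (R.map (Injective.ι N)))
        epi_g := inferInstanceAs (Epi (R.map (cokernel.π (Injective.ι N)))) }
  induction n generalizing N with
  | zero =>
    obtain ⟨I, Q, f, g, w, _, _, h⟩ := this N
    exact .zero _ _ _ h (Injective.injective_of_adjoint adj I) (hF g)
  | succ n ih =>
    obtain ⟨I, Q, f, g, w, _, _, h⟩ := this N
    exact .succ _ _ _ h (Injective.injective_of_adjoint adj I) (ih Q)

end DerivedVanishing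

lemma ShortComplex.exact_epi_comp {X Y Z W : B} {p : X ⟶ Y} [Epi p] {a : Y ⟶ Z} {b : Z ⟶ W}
    {w : a ≫ b = 0} (h : (ShortComplex.mk a b w).Exact) {c : X ⟶ Z} (hc : p ≫ a = c) :
    (ShortComplex.mk c b (by rw [← hc, Category.assoc, w, comp_zero])).Exact := by
  subst hc
  let φ : ShortComplex.mk (p ≫ a) b (by rw [Category.assoc, w, comp_zero]) ⟶
      ShortComplex.mk a b w := { τ₁ := p, τ₂ := 𝟙 _, τ₃ := 𝟙 _ }
  have : Epi φ.τ₁ := inferInstanceAs (Epi p)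
  have : IsIso φ.τ₂ := inferInstanceAs (IsIso (𝟙 _))
  have : Mono φ.τ₃ := inferInstanceAs (Mono (𝟙 _))
  exact (ShortComplex.exact_iff_of_epi_of_isIso_of_mono φ).2 h

/-! ### From dimension shifting to vanishing of right derived functors. -/

section Augment

variable {A I Q : B} {f : A ⟶ I} {g : I ⟶ Q} {w : f ≫ g = 0}

/-- The augmentation of an injective resolution, as a morphism to its zeroth term. -/
def InjectiveResolution.augmentation (J : InjectiveResolution Q) : Q ⟶ J.cocomplex.X 0 :=
  J.ι.f 0

lemma InjectiveResolution.augmentation_comp_d (J : InjectiveResolution Q) :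
    J.augmentation ≫ J.cocomplex.d 0 1 = 0 :=
  J.ι_f_zero_comp_complex_d

lemma InjectiveResolution.exact_augmentation (J : InjectiveResolution Q) :
    (ShortComplex.mk _ _ J.augmentation_comp_d).Exact :=
  J.exact₀

instance (J : InjectiveResolution Q) : Mono J.augmentation :=
  inferInstanceAs (Mono (J.ι.f 0))

/-- The cocomplex underlying `InjectiveResolution.splice`. -/
def InjectiveResolution.spliceCocomplex (J : InjectiveResolution Q) (g : I ⟶ Q) :
    CochainComplex B ℕ :=
  CochainComplex.augment J.cocomplex (g ≫ J.augmentation)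
    (by rw [Category.assoc, J.augmentation_comp_d, comp_zero])

/-- An injective resolution of `A` obtained by splicing a short exact sequence `A ⟶ I ⟶ Q` with
`I` injective and an injective resolution of `Q`. -/
def InjectiveResolution.splice (h : (ShortComplex.mk f g w).ShortExact) (hI : Injective I)
    (J : InjectiveResolution Q) : InjectiveResolution A where
  cocomplex := J.spliceCocomplex g
  injective n := by
    cases n with
    | zero => exact hI
    | succ n => exact J.injective n
  ι := (CochainComplex.fromSingle₀Equiv _ _).symm ⟨f, by
    change f ≫ g ≫ J.augmentation = 0
    rw [reassoc_of% w, zero_comp]⟩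
  quasiIso := ⟨fun n => by
    have : Mono f := h.mono_f
    cases n
    · rw [CochainComplex.quasiIsoAt₀_iff, ShortComplex.quasiIso_iff_of_zeros]
      · have hw : f ≫ g ≫ J.augmentation = 0 := by rw [reassoc_of% w, zero_comp]
        let φ : ShortComplex.mk f g w ⟶ ShortComplex.mk f (g ≫ J.augmentation) hw :=
          { τ₁ := 𝟙 _, τ₂ := 𝟙 _, τ₃ := J.augmentation }
        have : Epi φ.τ₁ := inferInstanceAs (Epi (𝟙 _))
        have : IsIso φ.τ₂ := inferInstanceAs (IsIso (𝟙 _))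
        have : Mono φ.τ₃ := inferInstanceAs (Mono J.augmentation)
        refine (ShortComplex.exact_and_mono_f_iff_of_iso ?_).2
          ⟨(ShortComplex.exact_iff_of_epi_of_isIso_of_mono φ).1 h.exact,
            inferInstanceAs (Mono f)⟩
        exact ShortComplex.isoMk (Iso.refl _) (Iso.refl _) (Iso.refl _)
          (by
            refine (Category.id_comp f).trans (Eq.trans ?_ (Category.comp_id _).symm)
            exact (CochainComplex.fromSingle₀Equiv_symm_apply_f_zero
              (C := J.spliceCocomplex g) f _).symm)
          ((Category.id_comp _).trans (Category.comp_id _).symm)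
      all_goals rfl
    · rw [quasiIsoAt_iff_exactAt]
      · rename_i n
        rw [HomologicalComplex.exactAt_iff' _ n (n + 1) (n + 2) (by simp) (by simp)]
        cases n with
        | zero =>
          have : Epi g := h.epi_g
          exact ShortComplex.exact_epi_comp (p := g) J.exact_augmentation rfl
        | succ n => exact J.exact_succ n
      · apply CochainComplex.exactAt_succ_single_obj⟩

variable [HasInjectiveResolutions B] [Abelian C] (F : B ⥤ C) [F.Additive]

lemma isZero_rightDerived_succ_succ (h : (ShortComplex.mk f g w).ShortExact) (hI : Injective I)
    (n : ℕ) (hQ : IsZero ((F.rightDerived (n + 1)).obj Q)) :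
    IsZero ((F.rightDerived (n + 2)).obj A) := by
  let J : InjectiveResolution Q := injectiveResolution Q
  have h₁ := IsZero.of_iso hQ (J.isoRightDerivedObj F (n + 1)).symm
  refine IsZero.of_iso ?_ ((J.splice h hI).isoRightDerivedObj F (n + 2))
  erw [← HomologicalComplex.exactAt_iff_isZero_homology,
    HomologicalComplex.exactAt_iff' _ n (n + 1) (n + 2) (by simp) (by simp)] at h₁
  erw [← HomologicalComplex.exactAt_iff_isZero_homology,
    HomologicalComplex.exactAt_iff' _ (n + 1) (n + 2) (n + 3) (by simp) (by simp)]
  -- Beyond its first two terms, the spliced resolution is that of `Q` shifted by one.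
  exact h₁

lemma isZero_rightDerived_one [PreservesFiniteLimits F] (h : (ShortComplex.mk f g w).ShortExact)
    (hI : Injective I) (hg : Epi (F.map g)) : IsZero ((F.rightDerived 1).obj A) := by
  let J : InjectiveResolution Q := injectiveResolution Q
  refine IsZero.of_iso ?_ ((J.splice h hI).isoRightDerivedObj F 1)
  erw [← HomologicalComplex.exactAt_iff_isZero_homology,
    HomologicalComplex.exactAt_iff' _ 0 1 2 (by simp) (by simp)]
  -- By left exactness `F Q` is the kernel of the next differential, and `F I` surjects onto it.
  exact ShortComplex.exact_epi_comp (p := F.map g)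
    (J.exact_augmentation.map_of_mono_of_preservesKernel F
      (inferInstanceAs (Mono J.augmentation)) inferInstance) (F.map_comp _ _).symm

lemma DerivedVanishing.isZero_rightDerived [PreservesFiniteLimits F] {n : ℕ} {A : B}
    (hA : DerivedVanishing F n A) : IsZero ((F.rightDerived (n + 1)).obj A) := by
  induction hA with
  | zero f g w h hI hg => exact isZero_rightDerived_one F h hI hg
  | succ f g w h hI hQ ih => exact isZero_rightDerived_succ_succ F h hI _ ih

end Augment

end DerivedVanishing

end CategoryTheory

namespace RoosAxiom

/-! ### Existence of products and acyclic families. -/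

section Products

variable {C : Type*} [Category C] {Λ : Type*}

lemma hasProduct_of_isLimit_kernelFork [HasZeroMorphisms C] [HasKernels C] {M A B : Λ → C}
    (f : ∀ l, M l ⟶ A l) (g : ∀ l, A l ⟶ B l) (w : ∀ l, f l ≫ g l = 0)
    (h : ∀ l, IsLimit (KernelFork.ofι (f l) (w l))) [HasProduct A] [HasProduct B] :
    HasProduct M := by
  have hk (l : Λ) : (kernel.ι (Limits.Pi.map g) ≫ Pi.π A l) ≫ g l = 0 := by
    rw [Category.assoc, ← Limits.Pi.map_π, kernel.condition_assoc, zero_comp]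
  let p (l : Λ) := (KernelFork.IsLimit.lift' (h l) _ (hk l)).1
  have hp (l : Λ) : p l ≫ f l = _ := (KernelFork.IsLimit.lift' (h l) _ (hk l)).2
  have : ∀ l, Mono (f l) := fun l ↦ mono_of_isLimit_fork (h l)
  refine ⟨⟨⟨Fan.mk _ p, Fan.IsLimit.mk _ (fun s ↦ kernel.lift _ (Pi.lift fun l ↦ s.proj l ≫ f l) ?_)
    ?_ ?_⟩⟩⟩
  · ext l
    simp [w]
  · intro s l
    rw [← cancel_mono (f l)]
    simp [hp]
  · intro s m hm
    refine (cancel_mono (kernel.ι (Limits.Pi.map g))).1 (Limits.Pi.hom_ext _ _ fun l ↦ ?_)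
    simp [← hp, ← hm]

lemma hasProduct_piObj {ι : Type*} (X : Λ → ι → C) [∀ l, HasProduct (X l)]
    [∀ i, HasProduct fun l ↦ X l i] [HasProduct fun i ↦ ∏ᶜ fun l ↦ X l i] :
    HasProduct fun l ↦ ∏ᶜ X l := by
  refine ⟨⟨⟨Fan.mk (∏ᶜ fun i ↦ ∏ᶜ fun l ↦ X l i)
    (fun l ↦ Pi.lift fun i ↦ Pi.π _ i ≫ Pi.π _ l),
    Fan.IsLimit.mk _ (fun s ↦ Pi.lift fun i ↦ Pi.lift fun l ↦ s.proj l ≫ Pi.π _ i) ?_ ?_⟩⟩⟩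
  · intro s l
    ext i
    simp
  · intro s m hm
    refine Limits.Pi.hom_ext (f := fun i ↦ ∏ᶜ fun l ↦ X l i) _ _ fun i ↦
      Limits.Pi.hom_ext (f := fun l ↦ X l i) _ _ fun l ↦ ?_
    simp [← hm]

lemma hasProduct_obj {D : Type*} [Category D] (R : D ⥤ C) [R.IsRightAdjoint] (N : Λ → D)
    [HasProduct N] : HasProduct fun l ↦ R.obj (N l) :=
  have : HasLimit (Discrete.functor N ⋙ R) :=
    ⟨⟨⟨_, isLimitOfPreserves R (limit.isLimit (Discrete.functor N))⟩⟩⟩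
  hasLimit_of_iso (Discrete.natIso fun _ ↦ Iso.refl _ :
    Discrete.functor N ⋙ R ≅ Discrete.functor fun l ↦ R.obj (N l))

end Products

lemma mono_map_unit_app {C D : Type*} [Category C] [Category D] {L : C ⥤ D} {R : D ⥤ C}
    (adj : L ⊣ R) (M : C) : Mono (L.map (adj.unit.app M)) :=
  (SplitMono.mk _ (adj.left_triangle_components M)).mono

lemma isIso_map_unit_app {C D : Type*} [Category C] [Category D] {L : C ⥤ D} {R : D ⥤ C}
    (adj : L ⊣ R) [IsIso adj.counit] (M : C) : IsIso (L.map (adj.unit.app M)) :=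
  have : L.map (adj.unit.app M) = inv (adj.counit.app (L.obj M)) :=
    IsIso.eq_inv_of_inv_hom_id (adj.left_triangle_components M)
  this ▸ inferInstance

/-- Objects coming from a category with exact products are acyclic for products. -/
lemma derivedVanishing_obj {C : Type*} [Category C] [Abelian C] {D : Type*} [Category D]
    [Abelian D] {L : C ⥤ D} {R : D ⥤ C} (adj : L ⊣ R) (Λ : Type w) [EnoughInjectives D]
    [HasProductsOfShape Λ C] [HasProductsOfShape Λ D] [HasExactLimitsOfShape (Discrete Λ) D]
    [L.PreservesMonomorphisms] [R.PreservesEpimorphisms] (n : ℕ) (N : Discrete Λ ⥤ D) :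
    DerivedVanishing (prodFunctor Λ C) n (N ⋙ R) := by
  have := adj.isRightAdjoint
  have : ((Functor.whiskeringRight (Discrete Λ) _ _).obj L).PreservesMonomorphisms :=
    ⟨fun f hf ↦ by
      rw [NatTrans.mono_iff_mono_app] at hf ⊢
      intro l
      exact inferInstanceAs (Mono (L.map (f.app l)))⟩
  have : ((Functor.whiskeringRight (Discrete Λ) _ _).obj R).PreservesEpimorphisms :=
    ⟨fun f hf ↦ by
      rw [NatTrans.epi_iff_epi_app] at hf ⊢
      intro l
      exact inferInstanceAs (Epi (R.map (f.app l)))⟩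
  refine DerivedVanishing.of_adjunction (adj.whiskerRight (Discrete Λ)) ?_ n N
  intro X Y g hg
  -- `R` commutes with products, so the product of the `R (g l)` is `R` of a product of
  -- epimorphisms, which is epi in `D`.
  have h := (preservesLimitNatIso (J := Discrete Λ) R).hom.naturality g
  have h₁ : Epi (R.map (lim.map g)) := inferInstance
  have h₂ : Epi ((lim ⋙ R).map g ≫ (preservesLimitNatIso (J := Discrete Λ) R).hom.app Y) :=
    inferInstanceAs (Epi (R.map (lim.map g) ≫ _))
  rw [h] at h₂
  have h₃ := @epi_of_epi _ _ _ _ _ _ _ h₂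
  exact h₃

/-! ### The abstract Roos axiom for a finite cover by localizations. -/

section Cover

variable {C : Type u} [Category.{v} C] [Abelian C] {ι : Type} [Fintype ι]
  {D : ι → Type u'} [∀ i, Category.{v'} (D i)] [∀ i, Abelian (D i)]
  {L : ∀ i, C ⥤ D i} {R : ∀ i, D i ⥤ C} (adj : ∀ i, L i ⊣ R i)
  [∀ i, (L i).PreservesMonomorphisms]
  (hL : ∀ M : C, (∀ i, IsZero ((L i).obj M)) → IsZero M)

include adj

include hL

/-- Each `L i` makes the `i`-th unit a split monomorphism by the triangle identity, so every `L i`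
kills the kernel. -/
lemma mono_lift_unit (M : C) :
    Mono (Pi.lift fun i ↦ (adj i).unit.app M) := by
  refine Preadditive.mono_of_isZero_kernel _ (hL _ fun i ↦ ?_)
  have := (adj i).isLeftAdjoint
  have := mono_map_unit_app (adj i) M
  have h : (L i).map (kernel.ι (Pi.lift fun i ↦ (adj i).unit.app M)) = 0 := by
    rw [← cancel_mono ((L i).map ((adj i).unit.app M)), zero_comp, ← (L i).map_comp,
      ← Pi.lift_π (fun i ↦ (adj i).unit.app M) i, kernel.condition_assoc, zero_comp,
      (L i).map_zero]
  rw [IsZero.iff_id_eq_zero, ← cancel_mono ((L i).map (kernel.ι _)), h, comp_zero, comp_zero]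

lemma hasProductsOfShape_of_adjunctions (Λ : Type w) [∀ i, HasProductsOfShape Λ (D i)] :
    HasProductsOfShape Λ C := by
  have hT (M : Λ → C) : HasProduct fun l ↦ ∏ᶜ fun i ↦ (R i).obj ((L i).obj (M l)) := by
    have (i : ι) : HasProduct fun l ↦ (R i).obj ((L i).obj (M l)) := by
      have := (adj i).isRightAdjoint
      exact hasProduct_obj _ _
    exact hasProduct_piObj _
  have (M : Λ → C) : HasProduct M := by
    let f (N : C) : N ⟶ ∏ᶜ fun i ↦ (R i).obj ((L i).obj N) := Pi.lift fun i ↦ (adj i).unit.app N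
    have (N : C) : Mono (f N) := mono_lift_unit adj hL N
    have := hT M
    have := hT fun l ↦ cokernel (f (M l))
    -- With `T = ∏ R i (L i -)`, every object `N` is the kernel of a map `T N ⟶ T (T N / N)`, and
    -- products of objects `T N` exist because each `R i` preserves products.
    refine hasProduct_of_isLimit_kernelFork (fun l ↦ f (M l))
      (fun l ↦ cokernel.π (f (M l)) ≫ f (cokernel (f (M l)))) (by simp) fun l ↦ ?_
    have : Mono (f (cokernel (f (M l)))) := mono_lift_unit adj hL _
    exact isKernelCompMono (Abelian.monoIsKernelOfCokernel _ (cokernelIsCokernel (f (M l)))) _ rfl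
  exact ⟨fun F ↦ hasLimit_of_iso (Discrete.natIsoFunctor (F := F)).symm⟩

lemma enoughInjectives_of_adjunctions [∀ i, EnoughInjectives (D i)] : EnoughInjectives C where
  presentation M := by
    have := mono_lift_unit adj hL M
    have (i : ι) := (adj i).isRightAdjoint
    have (i : ι) : Injective ((R i).obj (Injective.under ((L i).obj M))) :=
      Injective.injective_of_adjoint (adj i) _
    have : Mono ((Pi.lift fun i ↦ (adj i).unit.app M) ≫
        Limits.Pi.map fun i ↦ (R i).map (Injective.ι ((L i).obj M))) := mono_comp _ _
    exact ⟨{ J := ∏ᶜ fun i ↦ (R i).obj (Injective.under ((L i).obj M))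
             injective := inferInstance
             f := (Pi.lift fun i ↦ (adj i).unit.app M) ≫ Limits.Pi.map fun i ↦ (R i).map (Injective.ι _)
             mono := this }⟩

omit hL adj in
instance (Λ : Type w) [HasProductsOfShape Λ C] : (prodFunctor Λ C).IsRightAdjoint :=
  inferInstanceAs (lim : (Discrete Λ ⥤ C) ⥤ C).IsRightAdjoint

include hL

-- Here `s` contains every index where the family may be nonzero, and `n` is generalized since the
-- cokernel of the unit is used one level lower. The hypothesis `hLR` ensures that passing to `R a
-- (L a A)` creates no new indices.
omit [Fintype ι] in
lemma derivedVanishing_of_card_le (Λ : Type w) [∀ i, EnoughInjectives (D i)]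
    [HasProductsOfShape Λ C] [∀ i, HasProductsOfShape Λ (D i)]
    [∀ i, HasExactLimitsOfShape (Discrete Λ) (D i)]
    [∀ i, (R i).PreservesEpimorphisms] [∀ i, IsIso (adj i).counit]
    (hLR : ∀ (i j : ι) (M : C), IsZero ((L j).obj M) →
      IsZero ((L j).obj ((R i).obj ((L i).obj M))))
    (s : Finset ι) : ∀ (n : ℕ) (_ : s.card ≤ n + 1) (A : Discrete Λ ⥤ C)
      (_ : ∀ i ∉ s, ∀ l, IsZero ((L i).obj (A.obj l))), DerivedVanishing (prodFunctor Λ C) n A := by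
  have (i : ι) := (adj i).isLeftAdjoint
  have (i : ι) := (adj i).isRightAdjoint
  classical
  induction s using Finset.induction_on with
  | empty =>
    intro n _ A hA
    exact .of_isZero n ((Functor.isZero_iff _).2 fun l ↦ hL _ fun i ↦ hA i (by simp) l)
  | insert a s ha ih =>
    intro n hn A hA
    rw [Finset.card_insert_of_notMem ha] at hn
    let T : Discrete Λ ⥤ C := (A ⋙ L a) ⋙ R a
    have hT (n : ℕ) : DerivedVanishing (prodFunctor Λ C) n T := derivedVanishing_obj (adj a) Λ n _
    let η : A ⟶ T := Functor.whiskerLeft A (adj a).unit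
    have hη (l) : IsIso ((L a).map (η.app l)) :=
      isIso_map_unit_app (adj a) (A.obj l)
    have hK (l) : IsZero ((L a).obj ((kernel η).obj l)) := by
      have : Mono ((kernel.ι η).app l) := inferInstance
      have h : (L a).map ((kernel.ι η).app l) = 0 := by
        rw [← cancel_mono ((L a).map (η.app l)), zero_comp, ← (L a).map_comp, ← NatTrans.comp_app,
          kernel.condition, zero_app, (L a).map_zero]
      rw [IsZero.iff_id_eq_zero, ← cancel_mono ((L a).map ((kernel.ι η).app l)), h, comp_zero,
        comp_zero]
    have hQ (l) : IsZero ((L a).obj ((cokernel η).obj l)) := by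
      have : Epi ((cokernel.π η).app l) := inferInstance
      have h : (L a).map ((cokernel.π η).app l) = 0 := by
        rw [← cancel_epi ((L a).map (η.app l)), comp_zero, ← (L a).map_comp, ← NatTrans.comp_app,
          cokernel.condition, zero_app, (L a).map_zero]
      rw [IsZero.iff_id_eq_zero, ← cancel_epi ((L a).map ((cokernel.π η).app l)), h, zero_comp,
        zero_comp]
    have hK' : ∀ i ∉ s, ∀ l, IsZero ((L i).obj ((kernel η).obj l)) := fun i hi l ↦ by
      obtain rfl | hia := eq_or_ne i a
      · exact hK l
      · have : Mono ((kernel.ι η).app l) := inferInstance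
        exact IsZero.of_mono ((L i).map ((kernel.ι η).app l)) (hA i (by simp [hi, hia]) l)
    have hQ' : ∀ i ∉ s, ∀ l, IsZero ((L i).obj ((cokernel η).obj l)) := fun i hi l ↦ by
      obtain rfl | hia := eq_or_ne i a
      · exact hQ l
      · have : Epi ((cokernel.π η).app l) := inferInstance
        exact IsZero.of_epi ((L i).map ((cokernel.π η).app l))
          (hLR a i _ (hA i (by simp [hi, hia]) l))
    have hI : (ShortComplex.mk (Abelian.factorThruCoimage η) (cokernel.π η)
        (by rw [← cancel_epi (Abelian.coimage.π η)]; simp)).ShortExact := by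
      let φ : ShortComplex.mk η (cokernel.π η) (cokernel.condition η) ⟶
          ShortComplex.mk (Abelian.factorThruCoimage η) (cokernel.π η)
            (by rw [← cancel_epi (Abelian.coimage.π η)]; simp) :=
        { τ₁ := Abelian.coimage.π η, τ₂ := 𝟙 _, τ₃ := 𝟙 _ }
      have : Epi φ.τ₁ := inferInstanceAs (Epi (Abelian.coimage.π η))
      have : IsIso φ.τ₂ := inferInstanceAs (IsIso (𝟙 _))
      have : Mono φ.τ₃ := inferInstanceAs (Mono (𝟙 _))
      exact
        { exact := (ShortComplex.exact_iff_of_epi_of_isIso_of_mono φ).1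
            (ShortComplex.exact_cokernel η)
          mono_f := inferInstanceAs (Mono (Abelian.factorThruCoimage η))
          epi_g := inferInstanceAs (Epi (cokernel.π η)) }
    have hA' : (ShortComplex.mk (kernel.ι η) (Abelian.coimage.π η)
        (cokernel.condition _)).ShortExact :=
      { exact := ShortComplex.exact_cokernel _
        mono_f := inferInstanceAs (Mono (kernel.ι η))
        epi_g := inferInstanceAs (Epi (Abelian.coimage.π η)) }
    refine DerivedVanishing.of_shortExact hA' (ih n (by omega) _ hK') ?_
    cases n with
    | zero =>
      -- With a single chart the cokernel vanishes everywhere, so the coimage is the acyclic family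
      -- `T` itself and no degree is lost.
      obtain rfl : s = ∅ := by rw [← Finset.card_eq_zero]; omega
      have hz : IsZero (cokernel η) :=
        (Functor.isZero_iff _).2 fun l ↦ hL _ fun i ↦ hQ' i (by simp) l
      have : Epi η := Preadditive.epi_of_isZero_cokernel _ hz
      have : IsIso (Abelian.factorThruCoimage η) := inferInstance
      exact (hT 0).of_iso (asIso (Abelian.factorThruCoimage η))
    | succ n => exact DerivedVanishing.of_shortExact_left hI (hT _) (ih n (by omega) _ hQ')

/-- The Roos axiom for an abelian category with a finite family of exact colocalizations onto
abelian categories with exact products. -/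
theorem ab4StarN_of_adjunctions [∀ i, EnoughInjectives (D i)] [∀ i, HasProducts.{w} (D i)]
    [∀ i, AB4StarOfSize.{w} (D i)]
    [∀ i, (R i).PreservesEpimorphisms] [∀ i, IsIso (adj i).counit]
    (hLR : ∀ (i j : ι) (M : C), IsZero ((L j).obj M) →
      IsZero ((L j).obj ((R i).obj ((L i).obj M)))) :
    AB4StarN.{w} C ((Fintype.card ι : ℤ) - 1) := by
  have hP : HasProducts.{w} C := fun Λ ↦ hasProductsOfShape_of_adjunctions adj hL Λ
  have hE : EnoughInjectives C := enoughInjectives_of_adjunctions adj hL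
  refine ⟨inferInstance, hP, hE, fun Λ A n hn ↦ ?_⟩
  cases n with
  | zero =>
    -- Degree zero lies above the bound only for the empty cover, where every object is zero.
    have : IsEmpty ι := Fintype.card_eq_zero_iff.1 (by push_cast at hn; omega)
    exact hL _ fun i ↦ isEmptyElim i
  | succ n =>
    exact DerivedVanishing.isZero_rightDerived _ (derivedVanishing_of_card_le adj hL Λ hLR
      Finset.univ n (by push_cast at hn; rw [Finset.card_univ]; omega) _ (by simp))

end Cover

end RoosAxiom

namespace AlgebraicGeometry.Scheme.Modules

/-! ### Local detection of zero sheaves. -/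

section Zero

variable {X Y : Scheme.{u}} (M : X.Modules)

lemma isZero_iff : IsZero M ↔ ∀ U : X.Opens, Subsingleton Γ(M, U) := by
  refine ⟨fun h U ↦ ⟨fun x y ↦ ?_⟩, fun h ↦ ?_⟩
  · have h₀ : (𝟙 M : M ⟶ M) = 0 := h.eq_of_src _ _
    have hz (z : Γ(M, U)) : z = 0 := congr(Hom.app $h₀ U z)
    rw [hz x, hz y]
  · rw [IsZero.iff_id_eq_zero]
    ext U x
    exact Subsingleton.elim _ _

lemma subsingleton_of_iSup {ι : Type*} (U : ι → X.Opens) (hU : ⨆ i, U i = ⊤)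
    (h : ∀ i, ∀ V ≤ U i, Subsingleton Γ(M, V)) (W : X.Opens) : Subsingleton Γ(M, W) := by
  refine ⟨fun x y ↦ ?_⟩
  refine TopCat.Sheaf.eq_of_locally_eq' ⟨_, M.isSheaf⟩ (fun i ↦ U i ⊓ W) W
    (fun i ↦ homOfLE inf_le_right) ?_ x y fun i ↦ ?_
  · rw [← iSup_inf_eq, hU, top_inf_eq]
  · exact (h i _ inf_le_left).elim _ _

lemma isZero_of_iSup {ι : Type*} (U : ι → X.Opens) (hU : ⨆ i, U i = ⊤)
    (h : ∀ i, ∀ V ≤ U i, Subsingleton Γ(M, V)) : IsZero M :=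
  M.isZero_iff.2 (M.subsingleton_of_iSup U hU h)

lemma isZero_restrict_iff (f : Y ⟶ X) [IsOpenImmersion f] :
    IsZero (M.restrict f) ↔ ∀ V ≤ f.opensRange, Subsingleton Γ(M, V) := by
  rw [isZero_iff]
  refine ⟨fun h V hV ↦ ?_, fun h U ↦ h _ (f.image_le_opensRange U)⟩
  have := h (f ⁻¹ᵁ V)
  have e : f ''ᵁ (f ⁻¹ᵁ V) = V := by rw [f.image_preimage_eq_opensRange_inf]; exact inf_eq_right.2 hV
  rw [← e]
  exact this

lemma isZero_of_isZero_restrict {ι : Type*} {Y : ι → Scheme.{u}} (f : ∀ i, Y i ⟶ X)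
    [∀ i, IsOpenImmersion (f i)] (hf : ⨆ i, (f i).opensRange = ⊤)
    (h : ∀ i, IsZero (M.restrict (f i))) : IsZero M :=
  M.isZero_of_iSup _ hf fun i ↦ (M.isZero_restrict_iff (f i)).1 (h i)

end Zero

/-! ### Quasi-coherence is local on affine covers. -/

section Local

variable {X : Scheme.{u}} (M : X.Modules)

/-- Transport of a presentation along an isomorphism of modules. -/
def presentationOfIso {M N : X.Modules} (e : M ≅ N) (P : SheafOfModules.Presentation.{u} M) :
    SheafOfModules.Presentation.{u} N :=
  have : IsIso (C := SheafOfModules.{u} X.ringCatSheaf) e.hom :=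
    ⟨e.inv, e.hom_inv_id, e.inv_hom_id⟩
  P.ofIsIso e.hom

/-- The global presentation of a quasi-coherent module on an affine scheme. -/
def presentationOfIsQuasicoherent {R : CommRingCat.{u}} (M : (Spec R).Modules)
    [hM : SheafOfModules.IsQuasicoherent.{u} M] : SheafOfModules.Presentation.{u} M :=
  have := (isQuasicoherent_iff_isIso_fromTildeΓ M).1 hM
  presentationOfIso (asIso M.fromTildeΓ)
    (presentationTilde _ .univ (by simp) _ (Submodule.span_eq _))

/-- A presentation of `M.over U` from a presentation of the restriction of `M` to `U`. -/
def presentationOver (U : X.Opens) (P : SheafOfModules.Presentation.{u} (M.restrict U.ι)) :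
    (SheafOfModules.over M U).Presentation :=
  have : PreservesColimitsOfSize.{u, u} (U.sheafOfModulesEquivOver X.ringCatSheaf).inverse :=
    inferInstance
  let P' : SheafOfModules.Presentation.{u} (R := U.sheafRestrict.obj X.ringCatSheaf)
    (M.restrict U.ι) := P
  let E := U.sheafOfModulesEquivOver X.ringCatSheaf
  let e : E.functor.obj (SheafOfModules.over M U) ≅ M.restrict U.ι := (overFunctorEquiv U).app M
  let e' : E.inverse.obj (M.restrict U.ι) ≅ SheafOfModules.over M U :=
    E.inverse.mapIso e.symm ≪≫ (E.unitIso.app _).symm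
  (P'.map E.inverse (U.sheafOfModulesEquivOverInverseUnit _).symm).ofIsIso e'.hom

lemma isQuasicoherent_of_isAffineOpen {ι : Type u} (U : ι → X.Opens) (hU : ∀ i, IsAffineOpen (U i))
    (hcov : ⨆ i, U i = ⊤)
    (h : ∀ i, SheafOfModules.IsQuasicoherent.{u} (M.restrict (hU i).fromSpec)) :
    SheafOfModules.IsQuasicoherent.{u} M := by
  refine SheafOfModules.QuasicoherentData.isQuasicoherent (M := M)
    { I := ι
      X := U
      coversTop := (Opens.coversTop_iff _ _).2 hcov
      presentation i := M.presentationOver (U i) ?_ }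
  have e : restrictFunctor (hU i).fromSpec ⋙ restrictFunctor (hU i).isoSpec.hom ≅
      restrictFunctor (U i).ι :=
    (restrictFunctorComp _ _).symm ≪≫ restrictFunctorCongr (hU i).isoSpec_hom_fromSpec
  exact presentationOfIso (e.app M) (presentationRestrict (hU i).isoSpec.hom
    (presentationOfIsQuasicoherent (M.restrict (hU i).fromSpec)))

end Local

end AlgebraicGeometry.Scheme.Modules

/-! ### Exactness of restriction and of the tilde functor. -/

namespace CategoryTheory.Functor

/-- An additive right exact functor which preserves monomorphisms is left exact. -/
lemma preservesFiniteLimits_of_preservesMonomorphisms {C : Type u} [Category.{v} C] [Abelian C]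
    {D : Type u'} [Category.{v'} D] [Abelian D] (F : C ⥤ D) [F.Additive] [PreservesFiniteColimits F]
    [F.PreservesMonomorphisms] : PreservesFiniteLimits F := by
  refine F.preservesFiniteLimits_iff_forall_exact_map_and_mono.2 fun S hS ↦ ?_
  have := hS.mono_f
  exact ⟨(F.preservesFiniteColimits_iff_forall_exact_map_and_epi.1 inferInstance S hS).1,
    inferInstance⟩

end CategoryTheory.Functor

namespace AlgebraicGeometry.Scheme.Modules

lemma mono_iff_injective {X : Scheme.{u}} {M N : X.Modules} (φ : M ⟶ N) :
    Mono φ ↔ ∀ U, Function.Injective (φ.app U) := by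
  have : Mono φ ↔ Mono ((toPresheaf X).map φ) :=
    ⟨fun _ ↦ inferInstance, fun h ↦ (toPresheaf X).mono_of_mono_map h⟩
  rw [this, NatTrans.mono_iff_mono_app]
  refine ⟨fun h U ↦ (AddCommGrpCat.mono_iff_injective _).1 (h (.op U)),
    fun h U ↦ (AddCommGrpCat.mono_iff_injective _).2 (h U.unop)⟩

variable {X Y : Scheme.{u}} (f : Y ⟶ X) [IsOpenImmersion f]

@[simp]
lemma restrictFunctor_map_app {M N : X.Modules} (φ : M ⟶ N) (U : Y.Opens) :
    ((restrictFunctor f).map φ).app U = φ.app (f ''ᵁ U) := rfl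

instance : (restrictFunctor f).PreservesMonomorphisms where
  preserves φ h := (mono_iff_injective _).2 fun _ ↦ (mono_iff_injective φ).1 h _

instance : (restrictFunctor f).Additive where
  map_add := rfl

instance : PreservesFiniteLimits (restrictFunctor f) :=
  (restrictFunctor f).preservesFiniteLimits_of_preservesMonomorphisms

end AlgebraicGeometry.Scheme.Modules

namespace AlgebraicGeometry.tilde

variable (R : CommRingCat.{u})

instance : (tilde.functor R).PreservesMonomorphisms where
  preserves {M N} φ h := by
    rw [Scheme.Modules.mono_iff_injective]
    intro U s t hst
    -- Sections are families of elements of localizations at primes, and localization preserves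
    -- injections.
    refine Subtype.ext (funext fun p ↦ ?_)
    have : p.1.asIdeal.IsPrime := p.1.isPrime
    exact LocalizedModule.map_injective p.1.asIdeal.primeCompl φ.hom
      ((ModuleCat.mono_iff_injective φ).1 h) (congrFun (congrArg Subtype.val hst) p)

instance : PreservesFiniteLimits (tilde.functor R) :=
  (tilde.functor R).preservesFiniteLimits_of_preservesMonomorphisms

end AlgebraicGeometry.tilde

/-! ### Quasi-coherent sheaves form an abelian subcategory. -/

namespace CategoryTheory.Functor

variable {C : Type u} [Category.{v} C] {D : Type u'} [Category.{v'} D] (F : C ⥤ D)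
  [F.Full] [F.Faithful] (J : Type) [SmallCategory J]

lemma isClosedUnderLimitsOfShape_essImage [HasLimitsOfShape J C] [PreservesLimitsOfShape J F] :
    F.essImage.IsClosedUnderLimitsOfShape J := by
  refine .mk' ?_
  rintro _ ⟨G, hG⟩
  let K := essImage.liftFunctor G F hG
  exact ⟨limit K, ⟨preservesLimitIso F K ≪≫
    HasLimit.isoOfNatIso (essImage.liftFunctorCompIso G F hG)⟩⟩

lemma isClosedUnderColimitsOfShape_essImage [HasColimitsOfShape J C]
    [PreservesColimitsOfShape J F] : F.essImage.IsClosedUnderColimitsOfShape J := by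
  refine .mk' ?_
  rintro _ ⟨G, hG⟩
  let K := essImage.liftFunctor G F hG
  exact ⟨colimit K, ⟨preservesColimitIso F K ≪≫
    HasColimit.isoOfNatIso (essImage.liftFunctorCompIso G F hG)⟩⟩

end CategoryTheory.Functor

namespace CategoryTheory.ObjectProperty

variable {C : Type u} [Category.{v} C] [HasZeroMorphisms C] (P : ObjectProperty C)

lemma isClosedUnderKernels_of_isClosedUnderLimitsOfShape
    [P.IsClosedUnderLimitsOfShape WalkingParallelPair] : P.IsClosedUnderKernels where
  kernels_le := by
    rintro _ ⟨f, k, hk, h⟩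
    exact P.prop_of_isLimit hk (by rintro (_ | _); exacts [h.1, h.2])

lemma isClosedUnderCokernels_of_isClosedUnderColimitsOfShape
    [P.IsClosedUnderColimitsOfShape WalkingParallelPair] : P.IsClosedUnderCokernels where
  cokernels_le := by
    rintro _ ⟨f, k, hk, h⟩
    exact P.prop_of_isColimit hk (by rintro (_ | _); exacts [h.1, h.2])

end CategoryTheory.ObjectProperty

namespace AlgebraicGeometry.Scheme.Modules

/-- The property of being quasi-coherent. -/
abbrev isQuasicoherent (X : Scheme.{u}) : ObjectProperty X.Modules :=
  fun M ↦ SheafOfModules.IsQuasicoherent.{u} M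

variable (X : Scheme.{u})

variable {X} in
lemma isQuasicoherent_iff_restrict_fromSpec (M : X.Modules) :
    isQuasicoherent X M ↔ ∀ (U : X.Opens) (hU : IsAffineOpen U),
      isQuasicoherent _ (M.restrict hU.fromSpec) :=
  ⟨fun (_ : SheafOfModules.IsQuasicoherent.{u} M) _ _ ↦ isQuasicoherent_restrictFunctor _ _,
    fun h ↦ isQuasicoherent_of_isAffineOpen M (fun U : X.affineOpens ↦ U.1) (fun U ↦ U.2)
      (iSup_affineOpens_eq_top X) fun U ↦ h U.1 U.2⟩

lemma isQuasicoherent_Spec (R : CommRingCat.{u}) :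
    isQuasicoherent (Spec R) = (tilde.functor R).essImage :=
  funext fun M ↦ propext ((isQuasicoherent_iff_isIso_fromTildeΓ M).trans isIso_fromTildeΓ_iff)

instance : (isQuasicoherent X).IsClosedUnderIsomorphisms :=
  inferInstanceAs (SheafOfModules.isQuasicoherent X.ringCatSheaf).IsClosedUnderIsomorphisms

section

variable (J : Type) [SmallCategory J] [FinCategory J]

instance : (isQuasicoherent X).IsClosedUnderLimitsOfShape J where
  limitsOfShape_le := by
    rintro M ⟨p⟩
    refine (isQuasicoherent_iff_restrict_fromSpec M).2 fun U hU ↦ ?_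
    rw [isQuasicoherent_Spec]
    have := (tilde.functor Γ(X, U)).isClosedUnderLimitsOfShape_essImage J
    refine ObjectProperty.prop_of_isLimit _
      (isLimitOfPreserves (restrictFunctor hU.fromSpec) p.isLimit) fun j ↦ ?_
    rw [← isQuasicoherent_Spec]
    exact (isQuasicoherent_iff_restrict_fromSpec _).1 (p.prop_diag_obj j) U hU

instance : (isQuasicoherent X).IsClosedUnderColimitsOfShape J where
  colimitsOfShape_le := by
    rintro M ⟨p⟩
    refine (isQuasicoherent_iff_restrict_fromSpec M).2 fun U hU ↦ ?_
    rw [isQuasicoherent_Spec]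
    have := (tilde.functor Γ(X, U)).isClosedUnderColimitsOfShape_essImage J
    refine ObjectProperty.prop_of_isColimit _
      (isColimitOfPreserves (restrictFunctor hU.fromSpec) p.isColimit) fun j ↦ ?_
    rw [← isQuasicoherent_Spec]
    exact (isQuasicoherent_iff_restrict_fromSpec _).1 (p.prop_diag_obj j) U hU

end

instance : (isQuasicoherent X).IsClosedUnderFiniteProducts where
  isClosedUnderLimitsOfShape J _ :=
    have := Fintype.ofFinite J
    inferInstance

instance : (isQuasicoherent X).IsClosedUnderKernels :=
  ObjectProperty.isClosedUnderKernels_of_isClosedUnderLimitsOfShape _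

instance : (isQuasicoherent X).IsClosedUnderCokernels :=
  ObjectProperty.isClosedUnderCokernels_of_isClosedUnderColimitsOfShape _

instance : (isQuasicoherent X).ContainsZero where
  exists_zero := ⟨⊤_ _, (isZero_zero _).of_iso (HasZeroObject.zeroIsoTerminal).symm,
    ObjectProperty.prop_terminal _⟩

instance : Abelian (RoosAxiom.Qcoh X) :=
  inferInstanceAs (Abelian (isQuasicoherent X).FullSubcategory)

lemma isIso_presheaf_map {X : Scheme.{u}} (M : X.Modules) {U V : X.Opens} (i : U ⟶ V) (e : U = V) :
    IsIso (M.presheaf.map i.op) := by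
  subst e
  rw [Subsingleton.elim i (𝟙 _)]
  infer_instance

/-! ### Base change and direct images from affine opens. -/

section BaseChange

variable {X Y V P : Scheme.{u}} (f : Y ⟶ X) (j : V ⟶ X) (h : P ⟶ Y) (g : P ⟶ V)
  [IsOpenImmersion j] [IsOpenImmersion h] (e : h ≫ f = g ≫ j)

/-- The base change morphism from the restriction of a pushforward to the pushforward of the
restriction. -/
def restrictPushforward (M : Y.Modules) :
    ((pushforward f).obj M).restrict j ⟶ (pushforward g).obj (M.restrict h) :=
  ((restrictAdjunction j).homEquiv _ _).symm <|
    (pushforward f).map ((restrictAdjunction h).unit.app M) ≫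
      (pushforwardComp h f).hom.app _ ≫ (pushforwardCongr e).hom.app _ ≫
      (pushforwardComp g j).inv.app _

/-- By `hj` the image of `P` contains the preimage of `V`, so on sections the only nonformal factor
is a restriction map of `M` between equal opens. -/
lemma isIso_restrictPushforward (hj : f ⁻¹ᵁ j.opensRange ≤ h.opensRange) (M : Y.Modules) :
    IsIso (restrictPushforward f j h g e M) := by
  rw [Hom.isIso_iff_isIso_app]
  intro O
  have hle : f ⁻¹ᵁ (j ''ᵁ O) ≤ h.opensRange := le_trans (fun x hx ↦ j.image_le_opensRange O hx) hj
  have heq : h ''ᵁ (h ⁻¹ᵁ (f ⁻¹ᵁ (j ''ᵁ O))) = f ⁻¹ᵁ (j ''ᵁ O) := by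
    rw [h.image_preimage_eq_opensRange_inf]; exact inf_eq_right.2 hle
  have h₁ : IsIso (((pushforward f).map ((restrictAdjunction h).unit.app M)).app (j ''ᵁ O)) :=
    M.isIso_presheaf_map (homOfLE (h.image_preimage_le _)) heq
  rw [restrictPushforward, Adjunction.homEquiv_counit, Hom.comp_app, restrictFunctor_map_app,
    Hom.comp_app]
  have h₂ : IsIso ((pushforwardComp h f).hom.app (M.restrict h) ≫
    (pushforwardCongr e).hom.app (M.restrict h) ≫
      (pushforwardComp g j).inv.app (M.restrict h)) := inferInstance
  have h₃ : IsIso ((restrictAdjunction j).counit.app ((pushforward g).obj (M.restrict h))) :=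
    inferInstance
  exact IsIso.comp_isIso' (IsIso.comp_isIso' h₁ (Hom.isIso_iff_isIso_app.1 h₂ _))
    (Hom.isIso_iff_isIso_app.1 h₃ O)

end BaseChange

section Affine

variable {X : Scheme.{u}} {U V : X.Opens}

lemma isQuasicoherent_pushforward_specMap {R S : CommRingCat.{u}} (φ : R ⟶ S) (M : (Spec S).Modules)
    (hM : isQuasicoherent _ M) : isQuasicoherent _ ((pushforward (Spec.map φ)).obj M) := by
  have := (isQuasicoherent_iff_isIso_fromTildeΓ M).1 hM
  exact (isQuasicoherent_iff_isIso_fromTildeΓ _).2 (isIso_fromTildeΓ_pushforward φ M)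

/-- On a scheme with affine diagonal, the inclusions of affine open subschemes have quasi-coherent
direct images. -/
lemma isQuasicoherent_pushforward_fromSpec [IsAffineHom (pullback.diagonal (terminal.from X))]
    (hU : IsAffineOpen U) (M : (Spec Γ(X, U)).Modules) (hM : isQuasicoherent _ M) :
    isQuasicoherent _ ((pushforward hU.fromSpec).obj M) := by
  refine (isQuasicoherent_iff_restrict_fromSpec _).2 fun V hV ↦ ?_
  -- Affineness of the diagonal makes `U ⊓ V` affine; base change then turns the direct image over
  -- `V` into one along a map of affine schemes.
  have hW := hU.inf hV
  let iU : U ⊓ V ⟶ U := homOfLE inf_le_left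
  let iV : U ⊓ V ⟶ V := homOfLE inf_le_right
  have eU := hU.map_fromSpec hW iU.op
  have eV := hV.map_fromSpec hW iV.op
  have : IsOpenImmersion (Spec.map (X.presheaf.map iU.op) ≫ hU.fromSpec) := by
    rw [eU]; infer_instance
  have : IsOpenImmersion (Spec.map (X.presheaf.map iU.op)) := .of_comp _ hU.fromSpec
  have := isIso_restrictPushforward hU.fromSpec hV.fromSpec (Spec.map (X.presheaf.map iU.op))
    (Spec.map (X.presheaf.map iV.op)) (eU.trans eV.symm) (fun x hx ↦ by
      rw [hV.opensRange_fromSpec] at hx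
      have hx' : hU.fromSpec x ∈ hW.fromSpec.opensRange := by
        rw [hW.opensRange_fromSpec]
        exact ⟨hU.opensRange_fromSpec.le ⟨x, rfl⟩, hx⟩
      obtain ⟨y, hy⟩ := hx'
      refine ⟨y, hU.fromSpec.isOpenEmbedding.injective ?_⟩
      rw [← hy, ← eU]
      rfl) M
  refine (isQuasicoherent _).prop_of_iso (asIso (restrictPushforward hU.fromSpec hV.fromSpec
    (Spec.map (X.presheaf.map iU.op)) (Spec.map (X.presheaf.map iV.op)) (eU.trans eV.symm)
    M)).symm ?_
  exact isQuasicoherent_pushforward_specMap _ _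
    (have : SheafOfModules.IsQuasicoherent.{u} M := hM; isQuasicoherent_restrictFunctor _ _)

end Affine

/-! ### Epimorphisms of quasi-coherent sheaves and exactness of direct images. -/

section Epi

lemma epi_iff_epi_Γ {R : CommRingCat.{u}} {M N : (Spec R).Modules} (θ : M ⟶ N)
    (hM : isQuasicoherent _ M) (hN : isQuasicoherent _ N) :
    Epi θ ↔ Epi (moduleSpecΓFunctor.map θ) := by
  have : IsIso (fromTildeΓNatTrans.app M) := (isQuasicoherent_iff_isIso_fromTildeΓ M).1 hM
  have : IsIso (fromTildeΓNatTrans.app N) := (isQuasicoherent_iff_isIso_fromTildeΓ N).1 hN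
  rw [← (tilde.functor R).epi_map_iff_epi]
  exact (MorphismProperty.epimorphisms _).arrow_mk_iso_iff
    (Arrow.isoMk (asIso (fromTildeΓNatTrans.app M)) (asIso (fromTildeΓNatTrans.app N))
      (fromTildeΓNatTrans.naturality θ).symm) |>.symm

lemma epi_iff_surjective_top {R : CommRingCat.{u}} {M N : (Spec R).Modules} (θ : M ⟶ N)
    (hM : isQuasicoherent _ M) (hN : isQuasicoherent _ N) :
    Epi θ ↔ Function.Surjective (θ.app ⊤) := by
  rw [epi_iff_epi_Γ θ hM hN]
  exact ModuleCat.epi_iff_surjective _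

variable {X : Scheme.{u}} {M N : X.Modules} (φ : M ⟶ N)

lemma epi_of_epi_restrict {ι : Type*} {Y : ι → Scheme.{u}} (f : ∀ i, Y i ⟶ X)
    [∀ i, IsOpenImmersion (f i)] (hf : ⨆ i, (f i).opensRange = ⊤)
    (h : ∀ i, Epi ((restrictFunctor (f i)).map φ)) : Epi φ := by
  rw [Preadditive.epi_iff_isZero_cokernel]
  refine isZero_of_isZero_restrict _ f hf fun i ↦ ?_
  have := h i
  exact (isZero_cokernel_of_epi ((restrictFunctor (f i)).map φ)).of_iso
    (PreservesCokernel.iso (restrictFunctor (f i)) φ)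

lemma surjective_app_of_epi [Epi φ] (hM : isQuasicoherent _ M) (hN : isQuasicoherent _ N)
    {U : X.Opens} (hU : IsAffineOpen U) : Function.Surjective (φ.app U) := by
  have h := (epi_iff_surjective_top ((restrictFunctor hU.fromSpec).map φ)
    ((isQuasicoherent_iff_restrict_fromSpec M).1 hM U hU)
    ((isQuasicoherent_iff_restrict_fromSpec N).1 hN U hU)).1 inferInstance
  have h : Function.Surjective (φ.app (hU.fromSpec ''ᵁ ⊤)) := h
  have e : hU.fromSpec ''ᵁ ⊤ = U := by
    rw [Hom.image_top_eq_opensRange, hU.opensRange_fromSpec]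
  exact e ▸ h

lemma epi_of_surjective_app (hM : isQuasicoherent _ M) (hN : isQuasicoherent _ N)
    (h : ∀ U : X.Opens, IsAffineOpen U → Function.Surjective (φ.app U)) : Epi φ := by
  have (U : X.affineOpens) : IsOpenImmersion U.2.fromSpec := U.2.isOpenImmersion_fromSpec
  refine epi_of_epi_restrict φ (fun U : X.affineOpens ↦ U.2.fromSpec) ?_ fun U ↦ ?_
  · exact (iSup_congr fun U : X.affineOpens ↦ IsAffineOpen.opensRange_fromSpec U.2).trans
      (iSup_affineOpens_eq_top X)
  · refine (epi_iff_surjective_top _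
      ((isQuasicoherent_iff_restrict_fromSpec M).1 hM U U.2)
      ((isQuasicoherent_iff_restrict_fromSpec N).1 hN U U.2)).2 ?_
    refine h (U.2.fromSpec ''ᵁ ⊤) ?_
    rw [Hom.image_top_eq_opensRange, U.2.opensRange_fromSpec]
    exact U.2

lemma epi_pushforward_fromSpec [IsAffineHom (pullback.diagonal (terminal.from X))] {U : X.Opens}
    (hU : IsAffineOpen U) {M N : (Spec Γ(X, U)).Modules} (φ : M ⟶ N) [Epi φ]
    (hM : isQuasicoherent _ M) (hN : isQuasicoherent _ N) :
    Epi ((pushforward hU.fromSpec).map φ) := by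
  refine epi_of_surjective_app _ (isQuasicoherent_pushforward_fromSpec hU M hM)
    (isQuasicoherent_pushforward_fromSpec hU N hN) fun V hV ↦ ?_
  -- Sections of the direct image over `V` are sections over the preimage of `V`, which is affine
  -- since it maps isomorphically to `U ⊓ V`.
  refine surjective_app_of_epi φ hM hN ?_
  rw [← hU.fromSpec.isAffineOpen_iff_of_isOpenImmersion, Hom.image_preimage_eq_opensRange_inf,
    hU.opensRange_fromSpec]
  exact hU.inf hV

end Epi

end AlgebraicGeometry.Scheme.Modules

/-! ### The adjunctions attached to affine charts, and the theorem. -/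

namespace RoosAxiom

open AlgebraicGeometry.Scheme.Modules

section Spec

variable (R : CommRingCat.{u})

/-- The functor from modules to quasi-coherent sheaves on the spectrum. -/
def tildeQcoh : ModuleCat.{u} R ⥤ Qcoh (Spec R) :=
  ObjectProperty.lift _ (tilde.functor R) fun M ↦ by
    have := (tilde.functor R).obj_mem_essImage M
    rwa [← isQuasicoherent_Spec] at this

instance : (tildeQcoh R).Full :=
  have : (tilde.functor R).Full := tilde.fullyFaithfulFunctor.full
  Functor.Full.of_comp_faithful_iso (H := tilde.functor R) (ObjectProperty.liftCompιIso _ _ _)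

instance : (tildeQcoh R).Faithful :=
  have : (tilde.functor R).Faithful := tilde.fullyFaithfulFunctor.faithful
  Functor.Faithful.of_comp_iso (H := tilde.functor R) (ObjectProperty.liftCompιIso _ _ _)

instance : (tildeQcoh R).EssSurj where
  mem_essImage M := by
    have h : isQuasicoherent _ M.obj := M.property
    rw [isQuasicoherent_Spec] at h
    obtain ⟨N, ⟨e⟩⟩ := h
    exact ⟨N, ⟨ObjectProperty.isoMk _ e⟩⟩

instance : (tildeQcoh R).IsEquivalence where

lemma isZero_tildeQcoh_inv_iff (M : Qcoh (Spec R)) : IsZero ((tildeQcoh R).inv.obj M) ↔ IsZero M :=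
  ⟨fun h ↦ ((tildeQcoh R).map_isZero h).of_iso
    ((tildeQcoh R).asEquivalence.counitIso.app M).symm, (tildeQcoh R).inv.map_isZero⟩

end Spec

section

variable {X : Scheme.{u}}

instance : (ObjectProperty.ι (isQuasicoherent X)).PreservesMonomorphisms :=
  (isQuasicoherent X).preservesMonomorphisms_ι_of_isNormalEpiCategory

lemma isZero_qcoh_iff (M : Qcoh X) : IsZero M ↔ IsZero M.obj := by
  rw [IsZero.iff_id_eq_zero, IsZero.iff_id_eq_zero]
  exact ⟨fun h ↦ congr(($h).hom), fun h ↦ ObjectProperty.hom_ext _ h⟩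

variable [IsAffineHom (pullback.diagonal (terminal.from X))] {U : X.Opens} (hU : IsAffineOpen U)

/-- The restriction of quasi-coherent sheaves to an affine open subscheme. -/
def restrictQcoh : Qcoh X ⥤ Qcoh (Spec Γ(X, U)) :=
  ObjectProperty.lift _ (ObjectProperty.ι _ ⋙ restrictFunctor hU.fromSpec) fun M ↦
    (isQuasicoherent_iff_restrict_fromSpec M.obj).1 M.property U hU

/-- The direct image of quasi-coherent sheaves from an affine open subscheme. -/
def pushforwardQcoh : Qcoh (Spec Γ(X, U)) ⥤ Qcoh X :=
  ObjectProperty.lift _ (ObjectProperty.ι _ ⋙ pushforward hU.fromSpec) fun M ↦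
    isQuasicoherent_pushforward_fromSpec hU M.obj M.property

/-- Restriction of quasi-coherent sheaves is left adjoint to direct image. -/
def restrictQcohAdjunction : restrictQcoh hU ⊣ pushforwardQcoh hU :=
  (restrictAdjunction hU.fromSpec).restrictFullyFaithful
    (ObjectProperty.fullyFaithfulι _) (ObjectProperty.fullyFaithfulι _)
    (Iso.refl _) (Iso.refl _)

instance : (pushforwardQcoh hU).Full := inferInstanceAs (ObjectProperty.lift _ _ _).Full
instance : (pushforwardQcoh hU).Faithful := inferInstanceAs (ObjectProperty.lift _ _ _).Faithful

instance : (restrictQcoh hU).PreservesMonomorphisms where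
  preserves {M N} φ _ := by
    have : Mono φ.hom := inferInstanceAs (Mono ((ObjectProperty.ι (isQuasicoherent X)).map φ))
    exact (ObjectProperty.ι _).mono_of_mono_map
      (inferInstanceAs (Mono ((restrictFunctor hU.fromSpec).map φ.hom)))

instance : (tildeQcoh Γ(X, U) ⋙ pushforwardQcoh hU).PreservesEpimorphisms where
  preserves {M N} φ _ := by
    refine (ObjectProperty.ι _).epi_of_epi_map ?_
    have : Epi ((tilde.functor Γ(X, U)).map φ) := inferInstance
    exact epi_pushforward_fromSpec hU ((tilde.functor Γ(X, U)).map φ) ((tildeQcoh _).obj M).property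
      ((tildeQcoh _).obj N).property

omit [IsAffineHom (pullback.diagonal (terminal.from X))] in
lemma isZero_restrictQcoh_iff (M : Qcoh X) :
    IsZero ((restrictQcoh hU).obj M) ↔ ∀ V ≤ U, Subsingleton Γ(M.obj, V) := by
  rw [isZero_qcoh_iff]
  refine (isZero_restrict_iff M.obj hU.fromSpec).trans ?_
  rw [hU.opensRange_fromSpec]

end

end RoosAxiom

open RoosAxiom AlgebraicGeometry.Scheme.Modules in
theorem mainTheorem3 (X : Scheme.{u}) [CompactSpace X]
    -- `X` is semi-separated: its diagonal `X ⟶ X × X` is an affine morphism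
    [IsAffineHom (pullback.diagonal (terminal.from X))]
    (N : ℕ) (U : Fin N → X.Opens) (hU : ∀ α, IsAffineOpen (U α)) (hcov : ⨆ α, U α = ⊤) :
    RoosAxiom.AB4StarN.{u} (RoosAxiom.Qcoh X) ((N : ℤ) - 1) := by
  have hL (α : Fin N) (M : Qcoh X) :
      IsZero ((restrictQcoh (hU α) ⋙ (tildeQcoh _).inv).obj M) ↔
        ∀ V ≤ U α, Subsingleton Γ(M.obj, V) :=
    (isZero_tildeQcoh_inv_iff _ _).trans (isZero_restrictQcoh_iff (hU α) M)
  -- Module categories serve as local categories because they have exact products and enough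
  -- injectives.
  have h := ab4StarN_of_adjunctions.{u} (C := Qcoh X) (D := fun α ↦ ModuleCat.{u} Γ(X, U α))
    (L := fun α ↦ restrictQcoh (hU α) ⋙ (tildeQcoh _).inv)
    (R := fun α ↦ tildeQcoh _ ⋙ pushforwardQcoh (hU α))
    (fun α ↦ (restrictQcohAdjunction (hU α)).comp (tildeQcoh _).asEquivalence.symm.toAdjunction)
    (fun M hM ↦ (isZero_qcoh_iff M).2
      (isZero_of_iSup M.obj U hcov fun α ↦ (hL α M).1 (hM α)))
    (fun α β M hM ↦ by
      let e : (tildeQcoh _ ⋙ pushforwardQcoh (hU α)).obj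
          ((restrictQcoh (hU α) ⋙ (tildeQcoh _).inv).obj M) ≅
          (pushforwardQcoh (hU α)).obj ((restrictQcoh (hU α)).obj M) :=
        (pushforwardQcoh (hU α)).mapIso ((tildeQcoh _).asEquivalence.counitIso.app _)
      refine ((restrictQcoh (hU β) ⋙ (tildeQcoh _).inv).mapIso e).isZero_iff.2 ((hL β _).2 ?_)
      -- Over `V ≤ U β`, sections of the direct image of the restriction of `M` are sections of `M`
      -- over `U α ⊓ V`, which still lies in `U β`.
      exact fun V hV ↦ (hL β M).1 hM _ (((hU α).fromSpec.image_preimage_le V).trans hV))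
  simpa using h

end
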